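/- Let $(X,\mathsf d,\mathfrak m)$ be a metric measure space, i.e. $(X,\mathsf d)$ is a complete separable metric space and $\mathfrak m$ is a nonnegative $\sigma$-finite Borel measure on $X$. **Definitions.** For $f:X\to\mathbb R$ let $|Df|(x)=\limsup_{y\to x}\frac{|f(y)-f(x)|}{\mathsf d(y,x)}$ be its slope ($0$ at isolated points). A function $G\in L^2(X,\mathfrak m)$ is a relaxed gradient of $f\in L^2(X,\mathfrak m)$ if there are Lipschitz functions $f_k\in L^2(X,\mathfrak m)$ with $|Df_k|\in L^2(X,\mathfrak m)$ and $\tilde G\in L^2(X,\mathfrak m)$ such that $f_k\to f$ strongly and $|Df_k|\rightharpoonup\tilde G$ weakly in $L^2(X,\mathfrak m)$, and $\tilde G\le G$ $\mathfrak m$-a.e. The relaxed gradient of minimal $L^2$-norm is denoted by $|Df|_*$, and the Cheeger energy is $\mathsf{Ch}(f)=\frac12\int_X|Df|_*^2\,d\mathfrak m$, with $\mathsf{Ch}(f)=+\infty$ if $f$ has no relaxed gradient. Let $\partial^-\mathsf{Ch}(f)$ be the set of $\ell\in L^2(X,\mathfrak m)$ with $\int_X\ell(g-f)\,d\mathfrak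 m+\mathsf{Ch}(f)\le\mathsf{Ch}(g)$ for all $g\in L^2(X,\mathfrak m)$. Write $f\in D(\Delta)$ if $f\in L^2(X,\mathfrak m)$ and $\partial^-\mathsf{Ch}(f)\neq\emptyset$; then $\Delta f$ is the element of minimal $L^2$-norm of $\partial^-\mathsf{Ch}(f)$. The space has the $L^2$-Liouville property if every $f\in D(\Delta)$ with $\Delta f=0$ is $\mathfrak m$-a.e. equal to a real constant. **Proposition.** Suppose that there is a closed set $S\subset X$ such that 1. there are a smooth Riemannian manifold $(M,g)$ (finite-dimensional, without boundary, second countable, not necessarily complete) with geodesic distance $\mathsf d_g$ and Riemannian volume $d\mathrm{vol}_g$, a smooth function $\phi:M\to\mathbb R$, an open set $O\subset M$, and a bijective isometry $\psi$ from $(X\setminus S,\mathsf d\llcorner_{X\setminus S})$ onto $(O,\mathsf d_g\llcorner_O)$ that sends the measure $\mathfrak m\llcorner_{X\setminus S}$ to $e^{\phi}\,d\mathrm{vol}_g\llcorner_O$; 2. $\mathfrak m(S)=0$; 3. $X\setminus S$ is connected by rectifiable curves: for all $x,y\in X\setminus S$ there is a continuous curve $\gamma:[0,1]\to X\setminus S$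 of finite length with $\gamma(0)=x$ and $\gamma(1)=y$. Then $(X,\mathsf d,\mathfrak m)$ has the $L^2$-Liouville property. -/

import Mathlib

open MeasureTheory Filter Topology Set Manifold Bundle
open scoped ENNReal NNReal ContDiff

noncomputable section

section CheegerEnergy

variable {X : Type*} [MetricSpace X]

/-- The slope `|Df|(x) = limsup_{y → x} |f y - f x| / d(y, x)` of a real function on a metric space.
The limsup runs over the punctured neighbourhoods of `x`, so that it is `0` at an isolated point. -/
def slopeAt (f : X → ℝ) (x : X) : ℝ≥0∞ :=
  limsup (fun y => ENNReal.ofReal (|f y - f x| / dist y x)) (𝓝[≠] x)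

variable [MeasurableSpace X]

/-- `G` is a relaxed gradient of `f`: there are Lipschitz functions `F k ∈ L²(m)` with slopes in
`L²(m)`, such that `F k → f` strongly in `L²(m)`, the slopes of the `F k` converge weakly in `L²(m)`
to some `G'`, and `G' ≤ G` almost everywhere. -/
def IsRelaxedGradient (m : Measure X) (f G : Lp ℝ 2 m) : Prop :=
  ∃ (F : ℕ → X → ℝ) (hF : ∀ k, MemLp (F k) 2 m)
    (hD : ∀ k, MemLp (fun x => (slopeAt (F k) x).toReal) 2 m) (G' : Lp ℝ 2 m),
    (∀ k, ∃ K : ℝ≥0, LipschitzWith K (F k)) ∧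
    Tendsto (fun k => (hF k).toLp (F k)) atTop (𝓝 f) ∧
    (∀ h : Lp ℝ 2 m,
      Tendsto (fun k => inner ℝ h ((hD k).toLp (fun x => (slopeAt (F k) x).toReal))) atTop
        (𝓝 (inner ℝ h G'))) ∧
    ∀ᵐ x ∂m, G' x ≤ G x

/-- `G` is a minimal relaxed gradient of `f`, that is, a relaxed gradient of least `L²` norm. -/
def IsMinimalRelaxedGradient (m : Measure X) (f G : Lp ℝ 2 m) : Prop :=
  IsRelaxedGradient m f G ∧ ∀ G', IsRelaxedGradient m f G' → ‖G‖ ≤ ‖G'‖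

/-- The Cheeger energy `Ch(f) = ½ ∫ |Df|_*² dm`, where `|Df|_*` is the minimal relaxed gradient.
All minimal relaxed gradients have the same norm, so the infimum only selects that common value; it
is `∞` when `f` has no relaxed gradient. -/
def cheegerEnergy (m : Measure X) (f : Lp ℝ 2 m) : ℝ≥0∞ :=
  ⨅ (G : Lp ℝ 2 m) (_ : IsMinimalRelaxedGradient m f G),
    (1 / 2) * ∫⁻ x, ENNReal.ofReal (G x ^ 2) ∂m

/-- The subdifferential `∂⁻Ch(f)`: all `ℓ ∈ L²(m)` such that
`∫ ℓ (g - f) dm + Ch(f) ≤ Ch(g)` for every `g ∈ L²(m)`. -/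
def cheegerSubdifferential (m : Measure X) (f : Lp ℝ 2 m) : Set (Lp ℝ 2 m) :=
  {ℓ | ∀ g : Lp ℝ 2 m,
    ((∫ x, ℓ x * (g x - f x) ∂m : ℝ) : EReal) + (cheegerEnergy m f : EReal)
      ≤ (cheegerEnergy m g : EReal)}

/-- The domain `D(Δ)` of the Laplacian. -/
def laplacianDomain (m : Measure X) : Set (Lp ℝ 2 m) :=
  {f | (cheegerSubdifferential m f).Nonempty}

/-- `Δ f = ℓ`: the function `ℓ` is the element of minimal `L²` norm of `∂⁻Ch(f)`. -/
def IsLaplacian (m : Measure X) (f ℓ : Lp ℝ 2 m) : Prop :=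
  ℓ ∈ cheegerSubdifferential m f ∧ ∀ ℓ' ∈ cheegerSubdifferential m f, ‖ℓ‖ ≤ ‖ℓ'‖

/-- The `L²`-Liouville property: every `f ∈ D(Δ)` with `Δ f = 0` is a.e. equal to a constant. -/
def L2Liouville (m : Measure X) : Prop :=
  ∀ f ∈ laplacianDomain m, IsLaplacian m f 0 → ∃ c : ℝ, ∀ᵐ x ∂m, f x = c

end CheegerEnergy

section RiemannianVolume

variable {n : ℕ} {M : Type*} [TopologicalSpace M] [ChartedSpace (EuclideanSpace ℝ (Fin n)) M]
  [RiemannianBundle (fun x : M => TangentSpace (𝓡 n) x)]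

/-- The coordinate vector field `∂ᵢ` of the chart around `x`, at the point of coordinates `y`. -/
def coordVector (x : M) (y : EuclideanSpace ℝ (Fin n)) (i : Fin n) :
    TangentSpace (𝓡 n) ((chartAt (EuclideanSpace ℝ (Fin n)) x).symm y) :=
  mfderiv (𝓡 n) (𝓡 n) (chartAt (EuclideanSpace ℝ (Fin n)) x).symm y
    (EuclideanSpace.single i (1 : ℝ) : EuclideanSpace ℝ (Fin n))

/-- The matrix `g_{ij} = g(∂ᵢ, ∂ⱼ)` of the Riemannian metric in the chart around `x`, at the point
of coordinates `y`. -/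
def metricMatrix (x : M) (y : EuclideanSpace ℝ (Fin n)) : Matrix (Fin n) (Fin n) ℝ :=
  Matrix.of fun i j => inner ℝ (coordVector x y i) (coordVector x y j)

variable [MeasurableSpace M]

/-- The Riemannian volume of the domain of the chart around `x`: the measure that reads
`√(det g_{ij}) dy` in the coordinates of this chart (and vanishes outside of its domain). -/
def chartVolume (x : M) : Measure M :=
  ((volume.restrict (chartAt (EuclideanSpace ℝ (Fin n)) x).target).withDensity
    (fun y => ENNReal.ofReal (Real.sqrt (metricMatrix x y).det))).map
    (chartAt (EuclideanSpace ℝ (Fin n)) x).symm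

variable (n M) in
/-- The Riemannian volume measure `dvol_g`: the measure whose restriction to the domain of each chart
is `√(det g_{ij}) dy`. By the change of variables formula these local expressions agree on the
overlaps of charts, and the measure obtained by gluing them is the least measure that dominates all
of them. -/
def riemannianVolume : Measure M :=
  ⨆ x : M, chartVolume (n := n) x

variable (n) in
/-- The weighted Riemannian volume measure `e^φ dvol_g`. -/
def weightedVolume (φ : M → ℝ) : Measure M :=
  (riemannianVolume n M).withDensity fun p => ENNReal.ofReal (Real.exp (φ p))

end RiemannianVolume

/-- The set `A` is connected by rectifiable curves: any two of its points are joined by a curve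
`γ : [0,1] → A` of finite length. -/
def ConnectedByRectifiableCurves {X : Type*} [MetricSpace X] (A : Set X) : Prop :=
  ∀ x ∈ A, ∀ y ∈ A, ∃ γ : Path x y, (∀ t, γ t ∈ A) ∧ eVariationOn γ univ < ⊤

end

/-! If `Δf = 0`, then `0` is a subgradient of `Ch` at `f`. Testing against `g = 0` gives `Ch(f) ≤
Ch(0) = 0`, so `0` is a relaxed gradient of `f`: Lipschitz functions `F k` converge to `f` in L²
while their slopes converge weakly to some `G' ≤ 0`. Slopes are nonnegative, so pairing them with
the density of a finite measure `ν ≤ m` turns the weak convergence into convergence to zero in L¹(ν)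
(`exists_tendsto_of_isRelaxedGradient_zero`).

Around each point outside `S`, composing an inverse chart with the inverse of the isometry gives a
Lipschitz map `q` from a Euclidean ball into `X`; up to a positive factor, the image under `q` of
Lebesgue measure on the ball lies below `m` (`exists_local_parametrization`). The slope is an upper
gradient along the images of segments, which gives an L¹ Poincaré inequality for `F k ∘ q` on the
ball (`lintegral_lintegral_abs_sub_le`). In the limit `f ∘ q` is a.e. constant. Since null sets
transfer back to `X`, `f` is locally a.e. constant off `S`; connectedness of the complement and `m S
= 0` make the constant global (`exists_ae_eq_const_of_locally`). -/

/-! ### Slopes as upper gradients along Lipschitz curves -/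

section Slope

variable {X : Type*} [MetricSpace X]

theorem eventually_lt_of_slopeAt_lt {f : X → ℝ} {x : X} {b : ℝ≥0∞} (h : slopeAt f x < b) :
    ∀ᶠ y in 𝓝[≠] x, ENNReal.ofReal (|f y - f x| / dist y x) < b :=
  eventually_lt_of_limsup_lt h

theorem slopeAt_le_of_lipschitzWith {f : X → ℝ} {K : ℝ≥0} (hf : LipschitzWith K f) (x : X) :
    slopeAt f x ≤ K := by
  refine limsup_le_of_le (by isBoundedDefault) ?_
  filter_upwards [self_mem_nhdsWithin] with y hy
  have hd : 0 < dist y x := dist_pos.2 hy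
  rw [ENNReal.ofReal_le_iff_le_toReal (by simp), ENNReal.coe_toReal, div_le_iff₀ hd,
    ← Real.dist_eq]
  exact hf.dist_le_mul y x

theorem slopeAt_const (c : ℝ) (x : X) : slopeAt (fun _ : X => c) x = 0 :=
  le_antisymm (by simpa using slopeAt_le_of_lipschitzWith (LipschitzWith.const c) x) bot_le

/-- The limsup is a countable infimum over the radii `1/(k+1)`. At a fixed radius the supremum is
lower semicontinuous in `x`, because an admissible `y` stays admissible for nearby `x` and the
difference quotient is continuous there. -/
theorem measurable_slopeAt [MeasurableSpace X] [OpensMeasurableSpace X] {f : X → ℝ}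
    (hf : Continuous f) : Measurable (slopeAt f) := by
  have hbasis : ∀ x : X, (𝓝[≠] x).HasAntitoneBasis
      fun k : ℕ => Metric.ball x (1 / ((k : ℝ) + 1)) ∩ {x}ᶜ := fun x =>
    ⟨nhdsWithin_hasBasis Metric.nhds_basis_ball_inv_nat_succ _, fun i j hij =>
      inter_subset_inter_left _ (Metric.ball_subset_ball
        (one_div_le_one_div_of_le (by positivity) (by gcongr)))⟩
  have h : slopeAt f = fun x => ⨅ k : ℕ, ⨆ y ∈ Metric.ball x (1 / ((k : ℝ) + 1)) ∩ {x}ᶜ,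
      ENNReal.ofReal (|f y - f x| / dist y x) := by
    funext x
    rw [slopeAt, (hbasis x).toHasBasis.limsup_eq_iInf_iSup]
    simp
  rw [h]
  refine Measurable.iInf fun k => LowerSemicontinuous.measurable ?_
  intro x b hb
  simp only [lt_iSup_iff] at hb
  obtain ⟨y, ⟨hy, hyx⟩, hb⟩ := hb
  have hne : dist y x ≠ 0 := by simpa [dist_eq_zero] using hyx
  have hc : ContinuousAt (fun z => ENNReal.ofReal (|f y - f z| / dist y z)) x := by
    refine ENNReal.continuous_ofReal.continuousAt.comp ?_
    exact ContinuousAt.div (by fun_prop) (by fun_prop) hne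
  have hball : ∀ᶠ z in 𝓝 x, dist y z < 1 / ((k : ℝ) + 1) :=
    (continuous_const.dist continuous_id).continuousAt.eventually_lt continuousAt_const hy
  filter_upwards [hc.eventually (lt_mem_nhds hb), hball,
    (isOpen_compl_singleton (x := y)).mem_nhds (fun h => hyx h.symm)] with z hz hz1 hz2
  simp only [lt_iSup_iff]
  exact ⟨y, ⟨hz1, fun h => hz2 h.symm⟩, hz⟩

theorem enorm_deriv_comp_le_mul_slopeAt {f : X → ℝ} {p : ℝ → X} {t : ℝ} {c : ℝ≥0} (hc : c ≠ 0)
    (hp : ∀ᶠ s in 𝓝 t, dist (p s) (p t) ≤ c * |s - t|) :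
    ‖deriv (fun s => f (p s)) t‖ₑ ≤ c * slopeAt f (p t) := by
  have hpc : Tendsto p (𝓝 t) (𝓝 (p t)) := by
    rw [tendsto_iff_dist_tendsto_zero]
    refine squeeze_zero' (Eventually.of_forall fun _ => dist_nonneg) hp ?_
    have : ContinuousAt (fun s : ℝ => (c : ℝ) * |s - t|) t := by fun_prop
    simpa [ContinuousAt] using this
  rw [mul_comm, ← ENNReal.div_le_iff (by simpa using hc) (by simp)]
  refine le_of_forall_gt_imp_ge_of_dense fun b hb => ?_
  rw [ENNReal.div_le_iff (by simpa using hc) (by simp)]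
  induction b with
  | top => simp [ENNReal.top_mul, hc]
  | coe b =>
    have h1 : ∀ᶠ y in 𝓝 (p t), |f y - f (p t)| ≤ b * dist y (p t) := by
      have h2 := eventually_lt_of_slopeAt_lt hb
      rw [eventually_nhdsWithin_iff] at h2
      filter_upwards [h2] with y hy
      by_cases hyx : y = p t
      · simp [hyx]
      · have hd : 0 < dist y (p t) := dist_pos.2 hyx
        have h3 := (hy hyx).le
        rwa [ENNReal.ofReal_le_iff_le_toReal (by simp), ENNReal.coe_toReal, div_le_iff₀ hd] at h3
    have h4 : ‖deriv (fun s => f (p s)) t‖ ≤ b * c := by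
      refine norm_deriv_le_of_lip' (by positivity) ?_
      filter_upwards [hpc.eventually h1, hp] with s hs hs'
      rw [Real.norm_eq_abs, Real.norm_eq_abs, mul_assoc]
      exact hs.trans (by gcongr)
    rw [← ENNReal.coe_mul, enorm_le_coe]
    exact_mod_cast h4

/-- The composition `f ∘ p` is Lipschitz, hence absolutely continuous, so its increment is the
integral of its derivative, which is at most `c` times the slope. -/
theorem ofReal_abs_sub_le_lintegral_slopeAt {f : X → ℝ} {K : ℝ≥0} (hf : LipschitzWith K f)
    {p : ℝ → X} {c : ℝ≥0} (hc : c ≠ 0) (hp : LipschitzOnWith c p (Icc 0 1)) :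
    ENNReal.ofReal |f (p 1) - f (p 0)| ≤ c * ∫⁻ t in Icc (0 : ℝ) 1, slopeAt f (p t) := by
  have hac : AbsolutelyContinuousOnInterval (fun s => f (p s)) 0 1 := by
    refine LipschitzOnWith.absolutelyContinuousOnInterval (K := K * c) ?_
    rw [uIcc_of_le zero_le_one]
    exact hf.comp_lipschitzOnWith hp
  have h := hac.integral_deriv_eq_sub
  rw [← Real.enorm_eq_ofReal_abs, ← h, intervalIntegral.integral_of_le zero_le_one,
    ← lintegral_const_mul' _ _ ENNReal.coe_ne_top]
  refine (enorm_integral_le_lintegral_enorm _).trans ?_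
  -- The derivative bound needs the Lipschitz estimate on a full neighbourhood of `t`, hence the
  -- open interval.
  rw [restrict_Ioc_eq_restrict_Icc, ← restrict_Ioo_eq_restrict_Icc]
  refine setLIntegral_mono' measurableSet_Ioo fun t ht => ?_
  refine enorm_deriv_comp_le_mul_slopeAt hc ?_
  filter_upwards [Icc_mem_nhds ht.1 ht.2] with s hs
  simpa [Real.dist_eq] using hp.dist_le_mul s hs t (Ioo_subset_Icc_self ht)

end Slope

/-! ### An L¹ Poincaré inequality on convex sets -/

section Poincare

variable {E : Type*} [NormedAddCommGroup E] [NormedSpace ℝ E] [FiniteDimensional ℝ E]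
  [MeasurableSpace E] [BorelSpace E] (μ : Measure E) [μ.IsAddHaarMeasure]

theorem lintegral_comp_smul_add {r : ℝ} (hr : r ≠ 0) (a : E) {H : E → ℝ≥0∞} (hH : Measurable H) :
    ∫⁻ x, H (r • x + a) ∂μ =
      ENNReal.ofReal |(r ^ Module.finrank ℝ E)⁻¹| * ∫⁻ x, H x ∂μ := by
  have h1 : Measurable fun x => H (x + a) := hH.comp (measurable_add_const a)
  rw [← lintegral_map (f := fun x => H (x + a)) (g := fun x : E => r • x) h1
    (measurable_const_smul r), Measure.map_addHaar_smul μ hr, lintegral_smul_measure,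
    lintegral_add_right_eq_self H a, smul_eq_mul]

/-- The homothety of centre `a` and ratio `r` maps the convex set `B` into itself, and the change of
variables costs `r⁻ᵈ ≤ 2ᵈ`, where `d` is the dimension. -/
theorem setLIntegral_comp_smul_add_le {r : ℝ} (hr : 1 / 2 ≤ r) (hr1 : r ≤ 1) {a : E} {B : Set E}
    (hB : Convex ℝ B) (hBm : MeasurableSet B) (ha : a ∈ B) {G : E → ℝ≥0∞} (hG : Measurable G) :
    ∫⁻ x in B, G (r • x + (1 - r) • a) ∂μ ≤
      2 ^ Module.finrank ℝ E * ∫⁻ x in B, G x ∂μ := by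
  have hr0 : 0 < r := by linarith
  calc ∫⁻ x in B, G (r • x + (1 - r) • a) ∂μ
      ≤ ∫⁻ x in B, B.indicator G (r • x + (1 - r) • a) ∂μ := by
        refine setLIntegral_mono' hBm fun x hx => ?_
        rw [indicator_of_mem (hB hx ha hr0.le (by linarith) (by ring))]
    _ ≤ ∫⁻ x, B.indicator G (r • x + (1 - r) • a) ∂μ := setLIntegral_le_lintegral _ _
    _ = ENNReal.ofReal |(r ^ Module.finrank ℝ E)⁻¹| * ∫⁻ x, B.indicator G x ∂μ :=
        lintegral_comp_smul_add μ hr0.ne' _ (hG.indicator hBm)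
    _ ≤ 2 ^ Module.finrank ℝ E * ∫⁻ x in B, G x ∂μ := by
        rw [lintegral_indicator hBm]
        gcongr
        rw [abs_of_pos (by positivity), ← inv_pow, ENNReal.ofReal_pow (by positivity)]
        gcongr
        refine ENNReal.ofReal_le_of_le_toReal ?_
        simpa using inv_anti₀ (by norm_num : (0 : ℝ) < 1 / 2) hr

/-- One of `t` and `1 - t` is at least `1/2`. Integrating first in the variable that carries this
coefficient, with the other one frozen as centre, keeps the Jacobian bounded uniformly in `t`. -/
theorem lintegral_lintegral_segment_le {t : ℝ} (ht : t ∈ Icc (0 : ℝ) 1) {B : Set E}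
    (hB : Convex ℝ B) (hBm : MeasurableSet B) {G : E → ℝ≥0∞} (hG : Measurable G) :
    ∫⁻ x in B, ∫⁻ y in B, G ((1 - t) • x + t • y) ∂μ ∂μ ≤
      2 ^ Module.finrank ℝ E * (∫⁻ x in B, G x ∂μ) * μ B := by
  rcases le_total t (1 / 2) with h | h
  · rw [lintegral_lintegral_swap (by fun_prop)]
    rw [← setLIntegral_const]
    refine setLIntegral_mono' hBm fun y hy => ?_
    have := setLIntegral_comp_smul_add_le μ (r := 1 - t) (by linarith) (by linarith [ht.1])
      hB hBm hy hG
    simpa using this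
  · rw [← setLIntegral_const]
    refine setLIntegral_mono' hBm fun x hx => ?_
    have := setLIntegral_comp_smul_add_le μ h ht.2 hB hBm hx hG
    simpa [add_comm] using this

/-- A Poincaré inequality for Lipschitz functions on a metric space, pulled back by a Lipschitz
parametrization of a convex set. -/
theorem lintegral_lintegral_abs_sub_le {X : Type*} [MetricSpace X] [MeasurableSpace X]
    [BorelSpace X] {B : Set E} (hB : Convex ℝ B) (hBm : MeasurableSet B) {D : ℝ≥0} (hD : D ≠ 0)
    (hBD : ∀ x ∈ B, ∀ y ∈ B, dist x y ≤ D) {q : E → X} (hq : Measurable q) {C : ℝ≥0} (hC : C ≠ 0)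
    (hqC : LipschitzOnWith C q B) {f : X → ℝ} {K : ℝ≥0} (hf : LipschitzWith K f) :
    ∫⁻ x in B, ∫⁻ y in B, ENNReal.ofReal |f (q y) - f (q x)| ∂μ ∂μ ≤
      (C * D * (2 ^ Module.finrank ℝ E * μ B)) * ∫⁻ x in B, slopeAt f (q x) ∂μ := by
  set G : E → ℝ≥0∞ := fun x => slopeAt f (q x) with hGdef
  have hG : Measurable G := (measurable_slopeAt hf.continuous).comp hq
  have hpt : ∀ x ∈ B, ∀ y ∈ B, ENNReal.ofReal |f (q y) - f (q x)| ≤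
      (C * D : ℝ≥0) * ∫⁻ t in Icc (0 : ℝ) 1, G ((1 - t) • x + t • y) := by
    intro x hx y hy
    have hmaps : MapsTo (fun t : ℝ => (1 - t) • x + t • y) (Icc 0 1) B := fun t ht =>
      hB hx hy (by linarith [ht.2]) ht.1 (by ring)
    have hl : LipschitzOnWith D (fun t : ℝ => (1 - t) • x + t • y) (Icc 0 1) := by
      refine LipschitzOnWith.of_dist_le_mul fun s _ t _ => ?_
      have : (1 - s) • x + s • y - ((1 - t) • x + t • y) = (s - t) • (y - x) := by module
      rw [dist_eq_norm, this, norm_smul, mul_comm, ← dist_eq_norm, ← dist_eq_norm]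
      gcongr
      exact hBD y hy x hx
    have := ofReal_abs_sub_le_lintegral_slopeAt hf (mul_ne_zero hC hD) (hqC.comp hl hmaps)
    simpa using this
  calc ∫⁻ x in B, ∫⁻ y in B, ENNReal.ofReal |f (q y) - f (q x)| ∂μ ∂μ
      ≤ ∫⁻ x in B, ∫⁻ y in B, (C * D : ℝ≥0) *
          (∫⁻ t in Icc (0 : ℝ) 1, G ((1 - t) • x + t • y)) ∂μ ∂μ :=
        setLIntegral_mono' hBm fun x hx => setLIntegral_mono' hBm fun y hy => hpt x hx y hy
    _ = (C * D : ℝ≥0) * ∫⁻ t in Icc (0 : ℝ) 1, (∫⁻ x in B, ∫⁻ y in B,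
          G ((1 - t) • x + t • y) ∂μ ∂μ) := by
        simp_rw [lintegral_const_mul' _ _ ENNReal.coe_ne_top]
        congr 1
        have h1 : ∀ x, ∫⁻ y in B, (∫⁻ t in Icc (0 : ℝ) 1, G ((1 - t) • x + t • y)) ∂μ =
            ∫⁻ t in Icc (0 : ℝ) 1, (∫⁻ y in B, G ((1 - t) • x + t • y) ∂μ) := fun x =>
          lintegral_lintegral_swap (by fun_prop)
        simp_rw [h1]
        refine lintegral_lintegral_swap (Measurable.aemeasurable ?_)
        exact Measurable.lintegral_prod_right'
          (f := fun z : (E × ℝ) × E => G ((1 - z.1.2) • z.1.1 + z.1.2 • z.2)) (by fun_prop)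
    _ ≤ (C * D : ℝ≥0) * ∫⁻ t in Icc (0 : ℝ) 1,
          2 ^ Module.finrank ℝ E * (∫⁻ x in B, G x ∂μ) * μ B := by
        refine mul_le_mul' le_rfl ?_
        exact setLIntegral_mono' measurableSet_Icc fun t ht =>
          lintegral_lintegral_segment_le μ ht hB hBm hG
    _ = (C * D * (2 ^ Module.finrank ℝ E * μ B)) * ∫⁻ x in B, G x ∂μ := by
        rw [setLIntegral_const]
        simp
        ring

/-- If Lipschitz functions converge in `L¹` along a Lipschitz parametrization of a convex set while
their slopes tend to zero in `L¹`, then the limit is constant there. -/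
theorem ae_eq_const_of_tendsto_slopeAt {X : Type*} [MetricSpace X] [MeasurableSpace X]
    [BorelSpace X] {B : Set E} (hB : Convex ℝ B) (hBm : MeasurableSet B) (hBf : μ B ≠ ⊤) {D : ℝ≥0}
    (hD : D ≠ 0) (hBD : ∀ x ∈ B, ∀ y ∈ B, dist x y ≤ D) {q : E → X} (hq : Measurable q)
    {C : ℝ≥0} (hC : C ≠ 0) (hqC : LipschitzOnWith C q B) {f : X → ℝ} (hf : Measurable f)
    {F : ℕ → X → ℝ} (hF : ∀ k, ∃ K : ℝ≥0, LipschitzWith K (F k))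
    (h1 : Tendsto (fun k => ∫⁻ x in B, ‖F k (q x) - f (q x)‖ₑ ∂μ) atTop (𝓝 0))
    (h2 : Tendsto (fun k => ∫⁻ x in B, slopeAt (F k) (q x) ∂μ) atTop (𝓝 0)) :
    ∃ c : ℝ, ∀ᵐ x ∂(μ.restrict B), f (q x) = c := by
  by_cases h0 : μ B = 0
  · refine ⟨0, ?_⟩
    rw [Measure.restrict_eq_zero.2 h0]
    simp
  have hFm : ∀ k, Measurable (F k) := fun k => (hF k).elim fun K hK => hK.continuous.measurable
  set u : ℕ → ℝ≥0∞ := fun k => ∫⁻ x in B, ‖F k (q x) - f (q x)‖ₑ ∂μ with hu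
  -- Triangle inequality through `F k`: two terms measure its distance to `f`, the third is
  -- controlled by the Poincaré inequality. The left side does not depend on `k`.
  have hbound : ∀ k, ∫⁻ x in B, ∫⁻ y in B, ‖f (q y) - f (q x)‖ₑ ∂μ ∂μ ≤
      2 * μ B * u k + (C * D * (2 ^ Module.finrank ℝ E * μ B)) *
        ∫⁻ x in B, slopeAt (F k) (q x) ∂μ := by
    intro k
    obtain ⟨K, hK⟩ := hF k
    have hm := hFm k
    have hpt : ∀ x y, ‖f (q y) - f (q x)‖ₑ ≤ ‖F k (q y) - f (q y)‖ₑ +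
        (ENNReal.ofReal |F k (q y) - F k (q x)| + ‖F k (q x) - f (q x)‖ₑ) := by
      intro x y
      rw [← Real.enorm_eq_ofReal_abs]
      have : f (q y) - f (q x) = -(F k (q y) - f (q y)) + ((F k (q y) - F k (q x)) +
        (F k (q x) - f (q x))) := by ring
      rw [this]
      refine (enorm_add_le _ _).trans ?_
      rw [enorm_neg]
      gcongr
      exact enorm_add_le _ _
    calc ∫⁻ x in B, ∫⁻ y in B, ‖f (q y) - f (q x)‖ₑ ∂μ ∂μ
        ≤ ∫⁻ x in B, (u k + (∫⁻ y in B, ENNReal.ofReal |F k (q y) - F k (q x)| ∂μ +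
            ‖F k (q x) - f (q x)‖ₑ * μ B)) ∂μ := by
          refine lintegral_mono fun x => ?_
          refine (lintegral_mono fun y => hpt x y).trans_eq ?_
          rw [lintegral_add_left (by fun_prop), lintegral_add_right _ (by fun_prop),
            setLIntegral_const]
      _ = u k * μ B + (∫⁻ x in B, ∫⁻ y in B, ENNReal.ofReal |F k (q y) - F k (q x)| ∂μ ∂μ +
            u k * μ B) := by
          rw [lintegral_add_left (by fun_prop), lintegral_add_right _ (by fun_prop),
            setLIntegral_const, lintegral_mul_const _ (by fun_prop)]
      _ ≤ u k * μ B + ((C * D * (2 ^ Module.finrank ℝ E * μ B)) *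
            ∫⁻ x in B, slopeAt (F k) (q x) ∂μ + u k * μ B) := by
          gcongr
          exact lintegral_lintegral_abs_sub_le μ hB hBm hD hBD hq hC hqC hK
      _ = _ := by ring
  have hlim : Tendsto (fun k => 2 * μ B * u k + (C * D * (2 ^ Module.finrank ℝ E * μ B)) *
      ∫⁻ x in B, slopeAt (F k) (q x) ∂μ) atTop (𝓝 0) := by
    have e1 := ENNReal.Tendsto.const_mul h1 (a := 2 * μ B)
      (Or.inr (ENNReal.mul_ne_top (by simp) hBf))
    have e2 := ENNReal.Tendsto.const_mul h2 (a := C * D * (2 ^ Module.finrank ℝ E * μ B))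
      (Or.inr (ENNReal.mul_ne_top (by finiteness)
        (ENNReal.mul_ne_top (by finiteness) hBf)))
    simpa using e1.add e2
  have hzero : ∫⁻ x in B, ∫⁻ y in B, ‖f (q y) - f (q x)‖ₑ ∂μ ∂μ = 0 :=
    le_antisymm (ge_of_tendsto' hlim hbound) bot_le
  have hmeas : Measurable fun x => ∫⁻ y in B, ‖f (q y) - f (q x)‖ₑ ∂μ :=
    Measurable.lintegral_prod_right' (f := fun z : E × E => ‖f (q z.2) - f (q z.1)‖ₑ) (by fun_prop)
  rw [lintegral_eq_zero_iff hmeas] at hzero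
  have : (ae (μ.restrict B)).NeBot := by
    rw [ae_neBot]
    simpa using h0
  -- The inner integral vanishes for a.e. `x`; the value of `f ∘ q` at one such point is the
  -- constant.
  obtain ⟨x, hx⟩ := hzero.exists
  refine ⟨f (q x), ?_⟩
  have hx' : ∫⁻ y in B, ‖f (q y) - f (q x)‖ₑ ∂μ = 0 := hx
  rw [lintegral_eq_zero_iff (by fun_prop)] at hx'
  filter_upwards [hx'] with y hy
  simpa [sub_eq_zero] using hy

end Poincare

/-! ### From vanishing Laplacian to slopes vanishing in L¹ -/

section Energy

variable {X : Type*} [MetricSpace X] [MeasurableSpace X] {m : Measure X}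

theorem isRelaxedGradient_zero : IsRelaxedGradient m (0 : Lp ℝ 2 m) 0 := by
  have hs : ∀ x : X, (slopeAt (fun _ : X => (0 : ℝ)) x).toReal = 0 := fun x => by
    rw [slopeAt_const, ENNReal.toReal_zero]
  have h0 : MemLp (fun _ : X => (0 : ℝ)) 2 m := MemLp.zero
  have hD : MemLp (fun x => (slopeAt (fun _ : X => (0 : ℝ)) x).toReal) 2 m := by
    simpa only [hs] using h0
  refine ⟨fun _ _ => 0, fun _ => h0, fun _ => hD, 0, fun _ => ⟨0, LipschitzWith.const 0⟩, ?_, ?_,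
    Eventually.of_forall fun _ => le_rfl⟩
  · have : h0.toLp (fun _ : X => (0 : ℝ)) = 0 := MemLp.toLp_zero _
    simp only [this, tendsto_const_nhds]
  · intro h
    have : hD.toLp _ = 0 := by
      rw [Lp.eq_zero_iff_ae_eq_zero]
      filter_upwards [hD.coeFn_toLp] with x hx
      rw [hx, hs]
      rfl
    simp only [this, tendsto_const_nhds]

theorem lintegral_ofReal_sq_eq {α : Type*} [MeasurableSpace α] {m : Measure α} (G : Lp ℝ 2 m) :
    ∫⁻ x, ENNReal.ofReal (G x ^ 2) ∂m = ENNReal.ofReal (‖G‖ ^ 2) := by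
  have h : Integrable (fun x => G x ^ 2) m := (Lp.memLp G).integrable_sq
  rw [← ofReal_integral_eq_lintegral_ofReal h (Eventually.of_forall fun x => sq_nonneg _),
    ← real_inner_self_eq_norm_sq, L2.inner_def]
  simp [sq]

theorem cheegerEnergy_zero : cheegerEnergy m (0 : Lp ℝ 2 m) = 0 := by
  refine le_antisymm (iInf₂_le_of_le 0 ⟨isRelaxedGradient_zero, fun G' _ => by simp⟩ ?_) bot_le
  rw [lintegral_ofReal_sq_eq]
  simp

/-- A zero infimum is not taken over the empty set, and all minimal relaxed gradients have the same
norm; so a nonzero one would bound the infimum away from zero. -/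
theorem isRelaxedGradient_of_cheegerEnergy_eq_zero {f : Lp ℝ 2 m} (h : cheegerEnergy m f = 0) :
    IsRelaxedGradient m f 0 := by
  have hex : ∀ ε > 0, ∃ G, IsMinimalRelaxedGradient m f G ∧
      (1 / 2) * ENNReal.ofReal (‖G‖ ^ 2) < ε := by
    intro ε hε
    rw [← h, cheegerEnergy] at hε
    simpa only [iInf_lt_iff, exists_prop, lintegral_ofReal_sq_eq] using hε
  obtain ⟨G, hG, -⟩ := hex 1 one_pos
  by_cases h0 : G = 0
  · exact h0 ▸ hG.1
  · have hpos : 0 < (1 / 2 : ℝ≥0∞) * ENNReal.ofReal (‖G‖ ^ 2) :=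
      ENNReal.mul_pos (by simp) (by simpa using h0)
    obtain ⟨G', hG', hlt⟩ := hex _ hpos
    refine absurd hlt (not_lt.2 ?_)
    gcongr
    exact hG.2 G' hG'.1

theorem cheegerEnergy_eq_zero_of_isLaplacian {f : Lp ℝ 2 m} (h : IsLaplacian m f 0) :
    cheegerEnergy m f = 0 := by
  have h1 := h.1 0
  have h2 : ∫ x, (0 : Lp ℝ 2 m) x * ((0 : Lp ℝ 2 m) x - f x) ∂m = 0 := by
    refine integral_eq_zero_of_ae ?_
    filter_upwards [Lp.coeFn_zero ℝ 2 m] with x hx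
    rw [hx]
    simp
  rw [h2, cheegerEnergy_zero, EReal.coe_zero, zero_add, EReal.coe_ennreal_le_coe_ennreal_iff] at h1
  exact le_antisymm h1 bot_le

/-- If `0` is a relaxed gradient, the approximating slopes tend to zero in `L¹` of every finite
measure dominated by `m`. -/
theorem exists_tendsto_of_isRelaxedGradient_zero [SigmaFinite m] {f : Lp ℝ 2 m}
    (h : IsRelaxedGradient m f 0) :
    ∃ F : ℕ → X → ℝ, (∀ k, ∃ K : ℝ≥0, LipschitzWith K (F k)) ∧
      ∀ ν : Measure X, IsFiniteMeasure ν → ν ≤ m →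
        Tendsto (fun k => ∫⁻ x, ‖F k x - f x‖ₑ ∂ν) atTop (𝓝 0) ∧
        Tendsto (fun k => ∫⁻ x, slopeAt (F k) x ∂ν) atTop (𝓝 0) := by
  obtain ⟨F, hF, hD, G', hlip, hconv, hweak, hG'⟩ := h
  refine ⟨F, hlip, fun ν hν hνm => ⟨?_, ?_⟩⟩
  -- Hölder on the finite measure `ν` passes from L²(m) to L¹(ν).
  · have h1 : Tendsto (fun k => eLpNorm (F k - ⇑f) 2 m) atTop (𝓝 0) := by
      have := (Lp.tendsto_Lp_iff_tendsto_eLpNorm'' F hF f (Lp.memLp f)).1 (by simpa using hconv)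
      exact this
    have h2 : Tendsto (fun k => eLpNorm (F k - ⇑f) 2 m * ν univ ^ (1 / 2 : ℝ)) atTop (𝓝 0) := by
      have := ENNReal.Tendsto.mul_const h1 (b := ν univ ^ (1 / 2 : ℝ))
        (Or.inr (by finiteness))
      simpa using this
    refine tendsto_of_tendsto_of_tendsto_of_le_of_le tendsto_const_nhds h2 (fun _ => bot_le)
      fun k => ?_
    have hm : AEStronglyMeasurable (F k - ⇑f) ν :=
      ((hF k).1.sub (Lp.aestronglyMeasurable f)).mono_measure hνm
    have h3 := eLpNorm_le_eLpNorm_mul_rpow_measure_univ (μ := ν) (p := 1) (q := 2)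
      (by norm_num) hm
    rw [eLpNorm_one_eq_lintegral_enorm] at h3
    refine h3.trans ?_
    have : (1 / (1 : ℝ≥0∞).toReal - 1 / (2 : ℝ≥0∞).toReal) = (1 / 2 : ℝ) := by norm_num
    rw [this]
    gcongr
  · have hac : ν ≪ m := Measure.absolutelyContinuous_of_le hνm
    have hle : ν.rnDeriv m ≤ᵐ[m] 1 := Measure.rnDeriv_le_one_of_le hνm
    have hint : Integrable (fun x => (ν.rnDeriv m x).toReal) m :=
      Measure.integrable_toReal_rnDeriv
    have hle' : ∀ᵐ x ∂m, (ν.rnDeriv m x).toReal ≤ 1 := by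
      filter_upwards [hle] with x hx
      exact ENNReal.toReal_le_of_le_ofReal zero_le_one (by simpa using hx)
    -- The density of `ν` is integrable and at most `1`, hence square integrable: it is an
    -- admissible test function for the weak convergence.
    have hρ : MemLp (fun x => (ν.rnDeriv m x).toReal) 2 m := by
      rw [memLp_two_iff_integrable_sq hint.1]
      refine hint.mono (hint.1.pow 2) ?_
      filter_upwards [hle'] with x hx
      have h0 : 0 ≤ (ν.rnDeriv m x).toReal := ENNReal.toReal_nonneg
      rw [Real.norm_of_nonneg (by positivity), Real.norm_of_nonneg h0]
      nlinarith
    have hfin : ∀ k x, slopeAt (F k) x ≠ ⊤ := fun k x => by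
      obtain ⟨K, hK⟩ := hlip k
      exact ne_top_of_le_ne_top ENNReal.coe_ne_top (slopeAt_le_of_lipschitzWith hK x)
    have hinner : ∀ k, inner ℝ (hρ.toLp _) ((hD k).toLp _) =
        ∫ x, (slopeAt (F k) x).toReal ∂ν := by
      intro k
      rw [L2.inner_def, ← integral_rnDeriv_smul hac]
      refine integral_congr_ae ?_
      filter_upwards [hρ.coeFn_toLp, (hD k).coeFn_toLp] with x hx1 hx2
      rw [hx1, hx2]
      simp [mul_comm]
    have hlim := hweak (hρ.toLp _)
    -- The limit is nonpositive because `G' ≤ 0`, and nonnegative as a limit of integrals of slopes;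
    -- so it is zero.
    have hle0 : inner ℝ (hρ.toLp _) G' ≤ 0 := by
      rw [L2.inner_def]
      refine integral_nonpos_of_ae ?_
      filter_upwards [hρ.coeFn_toLp, hG', Lp.coeFn_zero ℝ 2 m] with x hx1 hx2 hx3
      rw [hx1]
      rw [hx3] at hx2
      have h0 : 0 ≤ (ν.rnDeriv m x).toReal := ENNReal.toReal_nonneg
      simpa using mul_nonpos_of_nonpos_of_nonneg hx2 h0
    simp only [hinner] at hlim
    have hge0 : 0 ≤ inner ℝ (hρ.toLp _) G' :=
      ge_of_tendsto' hlim fun k => integral_nonneg fun x => ENNReal.toReal_nonneg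
    rw [le_antisymm hle0 hge0] at hlim
    have hlim' := (ENNReal.continuous_ofReal.tendsto 0).comp hlim
    rw [ENNReal.ofReal_zero] at hlim'
    refine hlim'.congr fun k => ?_
    have hi : Integrable (fun x => (slopeAt (F k) x).toReal) ν :=
      ((hD k).mono_measure hνm).integrable (by norm_num)
    rw [Function.comp_apply, ofReal_integral_eq_lintegral_ofReal hi
      (Eventually.of_forall fun x => ENNReal.toReal_nonneg)]
    exact lintegral_congr fun x => ENNReal.ofReal_toReal (hfin k x)

end Energy

/-! ### Chart estimates: metric determinant and Lipschitz inverse charts -/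

/-- A Hermitian matrix whose quadratic form is at least `c |w|²` has determinant at least
`c ^ n`. -/
theorem pow_le_det_of_forall_le_dotProduct {n : ℕ} {A : Matrix (Fin n) (Fin n) ℝ}
    (hA : A.IsHermitian) {c : ℝ} (hc : 0 ≤ c)
    (h : ∀ w : EuclideanSpace ℝ (Fin n), c * ‖w‖ ^ 2 ≤ w ⬝ᵥ (A.mulVec w)) : c ^ n ≤ A.det := by
  rw [hA.det_eq_prod_eigenvalues]
  have h1 : ∀ i, c ≤ hA.eigenvalues i := fun i => by
    have := h (hA.eigenvectorBasis i)
    rw [hA.eigenvectorBasis.orthonormal.1 i] at this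
    rw [hA.eigenvalues_eq]
    simpa using this
  calc c ^ n = ∏ _i : Fin n, c := by simp
    _ ≤ ∏ i, hA.eigenvalues i := Finset.prod_le_prod (fun _ _ => hc) fun i _ => h1 i
    _ = _ := by simp

section MetricMatrix

variable {n : ℕ} {M : Type*} [TopologicalSpace M]
    [ChartedSpace (EuclideanSpace ℝ (Fin n)) M]
    [RiemannianBundle (fun x : M => TangentSpace (𝓡 n) x)]

theorem dotProduct_metricMatrix_mulVec (x : M) (y w : EuclideanSpace ℝ (Fin n)) :
    w ⬝ᵥ ((metricMatrix x y).mulVec w) =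
      ‖mfderiv (𝓡 n) (𝓡 n) (chartAt (EuclideanSpace ℝ (Fin n)) x).symm y w‖ ^ 2 := by
  have hw : mfderiv (𝓡 n) (𝓡 n) (chartAt (EuclideanSpace ℝ (Fin n)) x).symm y w =
      ∑ i, w i • coordVector x y i := by
    have h : w = ∑ i, w i • EuclideanSpace.single i (1 : ℝ) := by
      ext j
      simp [Finset.sum_apply, Pi.single_apply]
    conv_lhs => rw [h]
    exact (map_sum _ _ _).trans (Finset.sum_congr rfl fun i _ => map_smul _ _ _)
  rw [hw, ← real_inner_self_eq_norm_sq, sum_inner]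
  simp only [inner_sum, real_inner_smul_left, real_inner_smul_right, dotProduct, Matrix.mulVec,
    metricMatrix, Matrix.of_apply, Finset.mul_sum]
  refine Finset.sum_congr rfl fun i _ => Finset.sum_congr rfl fun j _ => by ring

theorem isHermitian_metricMatrix (x : M) (y : EuclideanSpace ℝ (Fin n)) :
    (metricMatrix x y).IsHermitian := by
  ext i j
  simp [metricMatrix, real_inner_comm]

end MetricMatrix

section ExtChart

variable {E : Type*} [NormedAddCommGroup E] [NormedSpace ℝ E]
  {H : Type*} [TopologicalSpace H] (I : ModelWithCorners ℝ E H)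
  {M : Type*} [PseudoEMetricSpace M] [ChartedSpace H M] [IsManifold I 1 M]
  [RiemannianBundle (fun x : M => TangentSpace I x)]
  [IsContinuousRiemannianBundle E (fun x : M => TangentSpace I x)]

attribute [local instance] normedAddCommGroupTangentSpaceVectorSpace
attribute [local instance] normedSpaceTangentSpaceVectorSpace

theorem exists_eventually_enorm_mfderivWithin_symm_le (x : M) :
    ∃ C > (0 : ℝ≥0), ∀ᶠ y in 𝓝[range I] (extChartAt I x x), ∀ v : E,
      ‖mfderivWithin 𝓘(ℝ, E) I (extChartAt I x).symm (range I) y v‖ₑ ≤ C * ‖v‖ₑ := by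
  obtain ⟨C, C_pos, hC⟩ := eventually_enorm_mfderivWithin_symm_extChartAt_lt I x
  refine ⟨C, C_pos, ?_⟩
  filter_upwards [hC] with y hy v
  exact (ContinuousLinearMap.le_opENorm _ _).trans (mul_le_mul' hy.le le_rfl)

/-- The inverse of a chart is locally Lipschitz for the Riemannian distance. -/
theorem exists_lipschitzOnWith_extChartAt_symm [IsRiemannianManifold I M] (x : M) :
    ∃ C : ℝ≥0, C ≠ 0 ∧ ∃ r > 0,
      LipschitzOnWith C (extChartAt I x).symm (Metric.ball (extChartAt I x x) r ∩ range I) := by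
  obtain ⟨C, C_pos, hC⟩ := exists_eventually_enorm_mfderivWithin_symm_le I x
  refine ⟨C, C_pos.ne', ?_⟩
  obtain ⟨r, r_pos, hr⟩ :=
    Metric.mem_nhdsWithin_iff.1 (inter_mem (extChartAt_target_mem_nhdsWithin x) hC)
  refine ⟨r, r_pos, fun a ha b hb => ?_⟩
  -- The image of the straight segment from `a` to `b` competes in the infimum defining the
  -- Riemannian distance, and its speed is at most `C` times that of the segment.
  let η := ContinuousAffineMap.lineMap (R := ℝ) a b
  set γ := (extChartAt I x).symm ∘ η
  have hη0 : ∀ t ∈ Icc (0 : ℝ) 1, η t ∈ Metric.ball (extChartAt I x x) r ∩ range I := by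
    intro t ht
    refine ((convex_ball _ _).inter I.convex_range).segment_subset ha hb ?_
    rw [segment_eq_image_lineMap]
    exact ⟨t, ht, rfl⟩
  have hη : Icc 0 1 ⊆ η ⁻¹' (extChartAt I x).target := fun t ht => (hr (hη0 t ht)).1
  have η_smooth : ContMDiffOn 𝓘(ℝ, ℝ) 𝓘(ℝ, E) 1 η (Icc 0 1) := by
    apply ContMDiff.contMDiffOn
    rw [contMDiff_iff_contDiff]
    exact ContinuousAffineMap.contDiff _
  rw [IsRiemannianManifold.out (I := I)]
  have : riemannianEDist I ((extChartAt I x).symm a) ((extChartAt I x).symm b) ≤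
      pathELength I γ 0 1 := by
    apply riemannianEDist_le_pathELength _ _ _ zero_le_one
    · exact (contMDiffOn_extChartAt_symm x).comp η_smooth hη
    · simp [γ, η, ContinuousAffineMap.coe_lineMap_eq]
    · simp [γ, η, ContinuousAffineMap.coe_lineMap_eq]
  apply this.trans
  rw [← lintegral_fderiv_lineMap_eq_edist, pathELength_eq_lintegral_mfderivWithin_Icc,
    ← lintegral_const_mul' _ _ ENNReal.coe_ne_top]
  apply setLIntegral_mono' measurableSet_Icc (fun t ht ↦ ?_)
  have : mfderivWithin 𝓘(ℝ, ℝ) I γ (Icc 0 1) t =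
      (mfderivWithin 𝓘(ℝ, E) I (extChartAt I x).symm (range I) (η t)) ∘L
        (mfderivWithin 𝓘(ℝ, ℝ) 𝓘(ℝ, E) η (Icc 0 1) t) := by
    apply mfderivWithin_comp
    · exact mdifferentiableWithinAt_extChartAt_symm (hη ht)
    · exact η_smooth.mdifferentiableOn one_ne_zero t ht
    · exact hη.trans (preimage_mono (extChartAt_target_subset_range x))
    · rw [uniqueMDiffWithinAt_iff_uniqueDiffWithinAt]
      exact uniqueDiffOn_Icc zero_lt_one t ht
  have : mfderivWithin 𝓘(ℝ, ℝ) I γ (Icc 0 1) t 1 =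
      (mfderivWithin 𝓘(ℝ, E) I (extChartAt I x).symm (range I) (η t))
        (mfderivWithin 𝓘(ℝ, ℝ) 𝓘(ℝ, E) η (Icc 0 1) t 1) :=
    congr($this 1)
  rw [this]
  rw [mfderivWithin_eq_fderivWithin]
  exact (hr (hη0 t ht)).2 _

end ExtChart

section Chart

variable {n : ℕ} {M : Type*} [EMetricSpace M]
    [ChartedSpace (EuclideanSpace ℝ (Fin n)) M] [IsManifold (𝓡 n) 1 M]
    [RiemannianBundle (fun x : M => TangentSpace (𝓡 n) x)]
    [IsContinuousRiemannianBundle (EuclideanSpace ℝ (Fin n))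
      (fun x : M => TangentSpace (𝓡 n) x)]

attribute [local instance] normedAddCommGroupTangentSpaceVectorSpace
attribute [local instance] normedSpaceTangentSpaceVectorSpace

/-- The differential of the chart has norm at most `C` near `x` and inverts that of the inverse
chart, so the latter stretches vectors by at least `C⁻¹`. The quadratic form of the metric is then
at least `C⁻²|w|²`, and its determinant at least `C⁻²ⁿ`. -/
theorem exists_eventually_le_sqrt_det_metricMatrix (x : M) :
    ∃ c : ℝ, 0 < c ∧ ∀ᶠ y in 𝓝 (chartAt (EuclideanSpace ℝ (Fin n)) x x),
      c ≤ Real.sqrt (metricMatrix x y).det := by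
  obtain ⟨C, hC, h⟩ := eventually_norm_mfderiv_extChartAt_lt (𝓡 n) x
  set e := chartAt (EuclideanSpace ℝ (Fin n)) x with he
  refine ⟨Real.sqrt (((C ^ 2)⁻¹) ^ n), by positivity, ?_⟩
  have hx : e x ∈ e.target := mem_chart_target _ x
  have hcont : Tendsto e.symm (𝓝 (e x)) (𝓝 x) := by
    have := e.continuousAt_symm hx
    rwa [ContinuousAt, e.left_inv (mem_chart_source _ x)] at this
  filter_upwards [hcont.eventually h, e.open_target.mem_nhds hx] with y hy hyt
  refine Real.sqrt_le_sqrt ?_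
  refine pow_le_det_of_forall_le_dotProduct (isHermitian_metricMatrix x y) (by positivity)
    fun w => ?_
  rw [dotProduct_metricMatrix_mulVec, inv_mul_le_iff₀ (by positivity), ← mul_pow]
  gcongr
  have hcomp : mfderiv (𝓡 n) (𝓡 n) (extChartAt (𝓡 n) x) (e.symm y)
      (mfderiv (𝓡 n) (𝓡 n) e.symm y w) = w := by
    have h1 := (mdifferentiable_chart (I := 𝓡 n) x).comp_symm_deriv hyt
    exact congr($h1 w)
  have h2 : ‖mfderiv (𝓡 n) (𝓡 n) (extChartAt (𝓡 n) x) (e.symm y)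
      (mfderiv (𝓡 n) (𝓡 n) e.symm y w)‖ ≤ C * ‖mfderiv (𝓡 n) (𝓡 n) e.symm y w‖ := by
    refine (ContinuousLinearMap.le_opNorm _ _).trans ?_
    gcongr
    exact hy.le
  rw [hcomp] at h2
  exact h2

end Chart

/-! ### Weighted Riemannian volume against Lebesgue measure -/

/-- A supremum of measures is not computed set by set; here the restriction of the supremum to `Aᶜ`
is already an upper bound of the family. -/
theorem iSup_measure_apply_eq_zero {ι α : Type*} [MeasurableSpace α] {μ : ι → Measure α}
    {A : Set α} (hA : MeasurableSet A) (h : ∀ i, μ i A = 0) : (⨆ i, μ i) A = 0 := by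
  have hle : (⨆ i, μ i) ≤ (⨆ i, μ i).restrict Aᶜ := by
    refine iSup_le fun i => ?_
    have hi : (μ i).restrict Aᶜ = μ i :=
      Measure.restrict_eq_self_of_ae_mem (by simpa [ae_iff] using h i)
    rw [← hi]
    exact Measure.restrict_mono le_rfl (le_iSup μ i)
  refine le_antisymm ((hle A).trans ?_) bot_le
  rw [Measure.restrict_apply hA, inter_compl_self, measure_empty]

section Volume

variable {n : ℕ} {M : Type*} [TopologicalSpace M]
    [ChartedSpace (EuclideanSpace ℝ (Fin n)) M]
    [RiemannianBundle (fun x : M => TangentSpace (𝓡 n) x)] [MeasurableSpace M] [BorelSpace M]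

theorem chartVolume_apply (x : M) {A : Set M} (hA : MeasurableSet A) :
    chartVolume (n := n) x A = ∫⁻ y in (chartAt (EuclideanSpace ℝ (Fin n)) x).symm ⁻¹' A ∩
        (chartAt (EuclideanSpace ℝ (Fin n)) x).target,
      ENNReal.ofReal (Real.sqrt (metricMatrix x y).det) := by
  set e := chartAt (EuclideanSpace ℝ (Fin n)) x
  have hm : AEMeasurable e.symm (volume.restrict e.target) :=
    e.continuousOn_symm.aemeasurable e.open_target.measurableSet
  rw [chartVolume, Measure.map_apply_of_aemeasurable
    (hm.mono_ac (withDensity_absolutelyContinuous _ _)) hA, withDensity_apply',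
    Measure.restrict_restrict' e.open_target.measurableSet]

/-- Transition maps are C¹, hence send Lebesgue null sets to null sets; nullity in the chart at `p`
passes to every chart. -/
theorem chartVolume_eq_zero_of_volume_eq_zero [IsManifold (𝓡 n) 1 M] (p x : M) {A : Set M}
    (hA : MeasurableSet A) (hAs : A ⊆ (chartAt (EuclideanSpace ℝ (Fin n)) p).source)
    (h0 : volume ((chartAt (EuclideanSpace ℝ (Fin n)) p).symm ⁻¹' A ∩
      (chartAt (EuclideanSpace ℝ (Fin n)) p).target) = 0) :
    chartVolume (n := n) x A = 0 := by
  rw [chartVolume_apply x hA]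
  set e := chartAt (EuclideanSpace ℝ (Fin n)) p with he
  set e' := chartAt (EuclideanSpace ℝ (Fin n)) x with he'
  refine setLIntegral_measure_zero _ _ ?_
  set s := (e.symm ⁻¹' A ∩ e.target) ∩ e.symm ⁻¹' e'.source with hs
  have hd : DifferentiableOn ℝ (e' ∘ e.symm) s := by
    have h1 : ContMDiffOn (𝓡 n) (𝓡 n) 1 (e' ∘ e.symm) s :=
      (contMDiffOn_chart (x := x)).comp ((contMDiffOn_chart_symm (x := p)).mono fun y hy => hy.1.2)
        fun y hy => hy.2
    exact (contMDiffOn_iff_contDiffOn.1 h1).differentiableOn one_ne_zero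
  have hs0 : volume s = 0 := measure_mono_null inter_subset_left h0
  refine measure_mono_null ?_
    (addHaar_image_eq_zero_of_differentiableOn_of_addHaar_eq_zero volume hd hs0)
  rintro y ⟨hyA, hyt⟩
  have hys : e'.symm y ∈ e.source := hAs hyA
  refine ⟨e (e'.symm y), ⟨⟨?_, e.map_source hys⟩, ?_⟩, ?_⟩
  · rw [mem_preimage, e.left_inv hys]
    exact hyA
  · rw [mem_preimage, e.left_inv hys]
    exact e'.map_target hyt
  · rw [Function.comp_apply, e.left_inv hys, e'.right_inv hyt]

theorem weightedVolume_eq_zero_of_volume_eq_zero [IsManifold (𝓡 n) 1 M] (φ : M → ℝ) (p : M)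
    {A : Set M} (hA : MeasurableSet A)
    (hAs : A ⊆ (chartAt (EuclideanSpace ℝ (Fin n)) p).source)
    (h0 : volume ((chartAt (EuclideanSpace ℝ (Fin n)) p).symm ⁻¹' A ∩
      (chartAt (EuclideanSpace ℝ (Fin n)) p).target) = 0) :
    weightedVolume n φ A = 0 :=
  withDensity_absolutelyContinuous _ _ <| iSup_measure_apply_eq_zero hA fun x =>
    chartVolume_eq_zero_of_volume_eq_zero p x hA hAs h0

theorem mul_volume_le_weightedVolume {φ : M → ℝ} {p : M} {B : Set (EuclideanSpace ℝ (Fin n))}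
    (hB : IsOpen B) (hBt : B ⊆ (chartAt (EuclideanSpace ℝ (Fin n)) p).target) {b c : ℝ}
    (hb : ∀ y ∈ B, b ≤ Real.exp (φ ((chartAt (EuclideanSpace ℝ (Fin n)) p).symm y)))
    (hc : ∀ y ∈ B, c ≤ Real.sqrt (metricMatrix p y).det) {A : Set M} (hA : MeasurableSet A) :
    ENNReal.ofReal b * ENNReal.ofReal c *
        volume (B ∩ (chartAt (EuclideanSpace ℝ (Fin n)) p).symm ⁻¹' A) ≤
      weightedVolume n φ A := by
  set e := chartAt (EuclideanSpace ℝ (Fin n)) p with he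
  set V := e.symm '' B with hV
  have hVo : IsOpen V := e.symm.isOpen_image_of_subset_source hB hBt
  have hA' : MeasurableSet (A ∩ V) := hA.inter hVo.measurableSet
  have hsub : B ∩ e.symm ⁻¹' A ⊆ e.symm ⁻¹' (A ∩ V) ∩ e.target := fun y hy =>
    ⟨⟨hy.2, y, hy.1, rfl⟩, hBt hy.1⟩
  have hsub' : e.symm ⁻¹' (A ∩ V) ∩ e.target ⊆ B := by
    rintro y ⟨⟨-, z, hz, hzy⟩, hyt⟩
    rwa [← e.symm.injOn (hBt hz) hyt hzy]
  classical
  -- The inverse chart is only controlled on its target, so it is replaced outside by the constant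
  -- `p`.
  have hBm : MeasurableSet (e.symm ⁻¹' (A ∩ V) ∩ e.target) := by
    have : e.symm ⁻¹' (A ∩ V) ∩ e.target = e.target.piecewise e.symm (fun _ => p) ⁻¹' (A ∩ V) ∩
        e.target := by
      ext y
      simp only [mem_inter_iff, mem_preimage, and_congr_left_iff]
      intro hy
      rw [piecewise_eq_of_mem _ _ _ hy]
    rw [this]
    exact ((e.continuousOn_symm.measurable_piecewise continuousOn_const
      e.open_target.measurableSet) hA').inter e.open_target.measurableSet
  calc ENNReal.ofReal b * ENNReal.ofReal c * volume (B ∩ e.symm ⁻¹' A)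
      ≤ ENNReal.ofReal b * (ENNReal.ofReal c * volume (e.symm ⁻¹' (A ∩ V) ∩ e.target)) := by
        rw [mul_assoc]
        gcongr
    _ ≤ ENNReal.ofReal b * chartVolume (n := n) p (A ∩ V) := by
        gcongr
        rw [chartVolume_apply p hA', ← setLIntegral_const]
        exact setLIntegral_mono' hBm fun y hy => ENNReal.ofReal_le_ofReal (hc y (hsub' hy))
    _ ≤ ENNReal.ofReal b * riemannianVolume n M (A ∩ V) := by
        gcongr
        exact le_iSup (fun x : M => chartVolume (n := n) x) p
    _ ≤ ∫⁻ z in A ∩ V, ENNReal.ofReal (Real.exp (φ z)) ∂(riemannianVolume n M) := by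
        rw [← setLIntegral_const]
        refine setLIntegral_mono' hA' ?_
        rintro _ ⟨-, y, hy, rfl⟩
        exact ENNReal.ofReal_le_ofReal (hb y hy)
    _ ≤ weightedVolume n φ A := by
        rw [weightedVolume, withDensity_apply _ hA]
        exact lintegral_mono_set inter_subset_left

end Volume

/-- All requirements hold near the centre, so one small radius serves them all. The constant `c` is
the product of `exp (φ p) / 2` and the lower bound for the volume density. -/
theorem exists_ball_chart {n : ℕ} {M : Type*} [EMetricSpace M]
    [ChartedSpace (EuclideanSpace ℝ (Fin n)) M] [IsManifold (𝓡 n) 1 M]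
    [RiemannianBundle (fun x : M => TangentSpace (𝓡 n) x)]
    [IsContinuousRiemannianBundle (EuclideanSpace ℝ (Fin n)) (fun x : M => TangentSpace (𝓡 n) x)]
    [IsRiemannianManifold (𝓡 n) M] [MeasurableSpace M] [BorelSpace M]
    {φ : M → ℝ} (hφ : Continuous φ) {O : Set M} (hO : IsOpen O) {p : M} (hp : p ∈ O) :
    ∃ (r : ℝ) (C : ℝ≥0) (c : ℝ≥0∞), 0 < r ∧ C ≠ 0 ∧ c ≠ 0 ∧ c ≠ ⊤ ∧
      Metric.ball (chartAt (EuclideanSpace ℝ (Fin n)) p p) r ⊆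
        (chartAt (EuclideanSpace ℝ (Fin n)) p).target ∧
      MapsTo (chartAt (EuclideanSpace ℝ (Fin n)) p).symm
        (Metric.ball (chartAt (EuclideanSpace ℝ (Fin n)) p p) r) O ∧
      LipschitzOnWith C (chartAt (EuclideanSpace ℝ (Fin n)) p).symm
        (Metric.ball (chartAt (EuclideanSpace ℝ (Fin n)) p p) r) ∧
      ∀ A : Set M, MeasurableSet A →
        c * volume (Metric.ball (chartAt (EuclideanSpace ℝ (Fin n)) p p) r ∩
          (chartAt (EuclideanSpace ℝ (Fin n)) p).symm ⁻¹' A) ≤ weightedVolume n φ A := by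
  obtain ⟨C, hC, r₁, hr₁, hlip⟩ := exists_lipschitzOnWith_extChartAt_symm (𝓡 n) p
  obtain ⟨c, hc, hdet⟩ := exists_eventually_le_sqrt_det_metricMatrix (n := n) p
  set e := chartAt (EuclideanSpace ℝ (Fin n)) p with he
  have hx : e p ∈ e.target := mem_chart_target _ p
  have hcont : Tendsto e.symm (𝓝 (e p)) (𝓝 p) := by
    have := e.continuousAt_symm hx
    rwa [ContinuousAt, e.left_inv (mem_chart_source _ p)] at this
  have hexp : ∀ᶠ z in 𝓝 p, Real.exp (φ p) / 2 ≤ Real.exp (φ z) := by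
    have h1 : Continuous fun z => Real.exp (φ z) := by fun_prop
    exact (h1.continuousAt.eventually (lt_mem_nhds (half_lt_self (Real.exp_pos (φ p))))).mono
      fun z hz => hz.le
  obtain ⟨r, hr, hball⟩ := Metric.eventually_nhds_iff_ball.1
    ((((e.open_target.eventually_mem hx).and (hcont.eventually (hO.eventually_mem hp))).and
      (hcont.eventually hexp)).and (hdet.and (Metric.ball_mem_nhds (e p) hr₁)))
  refine ⟨r, C, ENNReal.ofReal (Real.exp (φ p) / 2) * ENNReal.ofReal c, hr, hC, ?_,
    by finiteness, fun y hy => (hball y hy).1.1.1, fun y hy => (hball y hy).1.1.2, ?_,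
    fun A hA => ?_⟩
  · have := Real.exp_pos (φ p)
    simp [hc, this]
  · exact hlip.mono fun y hy => ⟨(hball y hy).2.2, by simp⟩
  · exact mul_volume_le_weightedVolume Metric.isOpen_ball (fun y hy => (hball y hy).1.1.1)
      (fun y hy => (hball y hy).1.2) (fun y hy => (hball y hy).2.1) hA

/-! ### Transport of the charts to the metric measure space -/

section Transport

variable {X M : Type*} [MetricSpace X] [MeasurableSpace X] [BorelSpace X] {m : Measure X}
  [EMetricSpace M] [MeasurableSpace M] [BorelSpace M] {W : Measure M}
  {S : Set X} {O : Set M}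

theorem measurableEmbedding_val_comp_isometryEquiv (hO : IsOpen O) (ψ : ↥(Sᶜ) ≃ᵢ ↥O) :
    MeasurableEmbedding fun x => (ψ x : M) :=
  (MeasurableEmbedding.subtype_coe hO.measurableSet).comp ψ.toHomeomorph.measurableEmbedding

theorem measure_inter_compl_eq (hS : IsClosed S) (hO : IsOpen O) (ψ : ↥(Sᶜ) ≃ᵢ ↥O)
    (hψ : (m.comap (Subtype.val : ↥(Sᶜ) → X)).map (fun x => (ψ x : M)) = W.restrict O)
    {D : Set X} (hD : MeasurableSet D) :
    m (D ∩ Sᶜ) = W ((fun x => (ψ x : M)) '' (Subtype.val ⁻¹' D)) := by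
  have hj := measurableEmbedding_val_comp_isometryEquiv hO ψ
  have hT : MeasurableSet (Subtype.val ⁻¹' D : Set ↥(Sᶜ)) := measurable_subtype_coe hD
  have hsub : (fun x => (ψ x : M)) '' (Subtype.val ⁻¹' D) ⊆ O := by
    rintro _ ⟨x, -, rfl⟩
    exact (ψ x).2
  have h := congr($hψ ((fun x => (ψ x : M)) '' (Subtype.val ⁻¹' D)))
  rw [hj.map_apply, hj.injective.preimage_image, Measure.restrict_apply (hj.measurableSet_image' hT),
    inter_eq_left.2 hsub, comap_subtype_coe_apply hS.isOpen_compl.measurableSet,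
    Subtype.image_preimage_coe, inter_comm] at h
  exact h

end Transport

/-- Near every point outside of `S`, the space is parametrized by a Euclidean ball, in a Lipschitz
way, and the Lebesgue measure of the ball is comparable with `m`. -/
theorem exists_local_parametrization
    {X : Type*} [MetricSpace X] [MeasurableSpace X] [BorelSpace X] {m : Measure X}
    {n : ℕ} {M : Type*} [EMetricSpace M]
    [ChartedSpace (EuclideanSpace ℝ (Fin n)) M] [IsManifold (𝓡 n) 1 M]
    [RiemannianBundle (fun x : M => TangentSpace (𝓡 n) x)]
    [IsContinuousRiemannianBundle (EuclideanSpace ℝ (Fin n)) (fun x : M => TangentSpace (𝓡 n) x)]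
    [IsRiemannianManifold (𝓡 n) M] [MeasurableSpace M] [BorelSpace M]
    {φ : M → ℝ} (hφ : Continuous φ) {S : Set X} (hS : IsClosed S) {O : Set M} (hO : IsOpen O)
    (ψ : ↥(Sᶜ) ≃ᵢ ↥O)
    (hψ : (m.comap (Subtype.val : ↥(Sᶜ) → X)).map (fun x => (ψ x : M)) =
      (weightedVolume n φ).restrict O) {x₀ : X} (hx₀ : x₀ ∈ Sᶜ) :
    ∃ (y₀ : EuclideanSpace ℝ (Fin n)) (r : ℝ) (q : EuclideanSpace ℝ (Fin n) → X) (C : ℝ≥0)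
      (c : ℝ≥0∞) (U : Set X), 0 < r ∧ C ≠ 0 ∧ c ≠ 0 ∧ c ≠ ⊤ ∧ Measurable q ∧ q y₀ = x₀ ∧
      LipschitzOnWith C q (Metric.ball y₀ r) ∧
      (∀ D, MeasurableSet D → c * volume (Metric.ball y₀ r ∩ q ⁻¹' D) ≤ m D) ∧
      IsOpen U ∧ x₀ ∈ U ∧ U ⊆ Sᶜ ∧
      ∀ D, MeasurableSet D → D ⊆ U → volume (Metric.ball y₀ r ∩ q ⁻¹' D) = 0 → m D = 0 := by
  classical
  set p : M := ((ψ ⟨x₀, hx₀⟩ : ↥O) : M) with hp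
  obtain ⟨r, C, c, hr, hC, hc, hc', hBt, hBO, hlip, hvol⟩ :=
    exists_ball_chart (n := n) hφ hO (p := p) (ψ ⟨x₀, hx₀⟩).2
  set e := chartAt (EuclideanSpace ℝ (Fin n)) p with he
  set B := Metric.ball (e p) r with hB
  have hpB : e p ∈ B := Metric.mem_ball_self hr
  -- The inverse chart followed by `ψ⁻¹` on the ball; the value `x₀` elsewhere makes it a globally
  -- defined measurable map.
  let q : EuclideanSpace ℝ (Fin n) → X := fun y =>
    if h : y ∈ B then (ψ.symm ⟨e.symm y, hBO h⟩ : X) else x₀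
  have hq : ∀ y (h : y ∈ B), q y = ψ.symm ⟨e.symm y, hBO h⟩ := fun y h => dif_pos h
  have hqlip : LipschitzOnWith C q B := by
    intro y hy z hz
    rw [hq y hy, hq z hz]
    refine le_trans (le_of_eq ?_) (hlip hy hz)
    exact ψ.symm.isometry.edist_eq _ _
  have hqm : Measurable q := by
    have h1 : Measurable (B.piecewise q fun _ => x₀) :=
      hqlip.continuousOn.measurable_piecewise continuousOn_const Metric.isOpen_ball.measurableSet
    convert h1 using 1
    funext y
    by_cases hy : y ∈ B
    · rw [piecewise_eq_of_mem _ _ _ hy]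
    · rw [piecewise_eq_of_notMem _ _ _ hy]
      exact dif_neg hy
  have hj := measurableEmbedding_val_comp_isometryEquiv hO ψ
  set j : ↥(Sᶜ) → M := fun x => (ψ x : M) with hjdef
  have hjc : Continuous j := continuous_subtype_val.comp ψ.continuous
  have hpre : ∀ D : Set X, B ∩ q ⁻¹' D = B ∩ e.symm ⁻¹' (j '' (Subtype.val ⁻¹' D)) := by
    intro D
    ext y
    refine and_congr_right fun hy => ?_
    rw [mem_preimage, hq y hy]
    constructor
    · intro h
      exact ⟨ψ.symm ⟨e.symm y, hBO hy⟩, h, by simp [hjdef]⟩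
    · rintro ⟨x, hx, hxy⟩
      have : x = ψ.symm ⟨e.symm y, hBO hy⟩ :=
        ψ.injective ((Subtype.ext hxy).trans (ψ.apply_symm_apply _).symm)
      rwa [← this]
  have hVo : IsOpen (e.symm '' B) :=
    e.symm.isOpen_image_of_subset_source Metric.isOpen_ball hBt
  -- `U` is the part of `X` that `ψ` sends into the image of the ball under the inverse chart.
  refine ⟨e p, r, q, C, c, Subtype.val '' (j ⁻¹' (e.symm '' B)), hr, hC, hc, hc', hqm, ?_, hqlip,
    fun D hD => ?_, hS.isOpen_compl.isOpenMap_subtype_val _ (hVo.preimage hjc), ?_, ?_,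
    fun D hD hDU h0 => ?_⟩
  · have hep : (⟨e.symm (e p), hBO hpB⟩ : ↥O) = ψ ⟨x₀, hx₀⟩ :=
      Subtype.ext (e.left_inv (mem_chart_source _ p))
    rw [hq _ hpB, hep, ψ.symm_apply_apply]
  · rw [hpre]
    refine (hvol _ (hj.measurableSet_image' (measurable_subtype_coe hD))).trans ?_
    rw [← measure_inter_compl_eq hS hO ψ hψ hD]
    exact measure_mono inter_subset_left
  · exact ⟨⟨x₀, hx₀⟩, ⟨e p, hpB, e.left_inv (mem_chart_source _ p)⟩, rfl⟩
  · rintro _ ⟨x, -, rfl⟩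
    exact x.2
  · have hDS : D ⊆ Sᶜ := hDU.trans (by rintro _ ⟨x, -, rfl⟩; exact x.2)
    have hjD : j '' (Subtype.val ⁻¹' D) ⊆ e.symm '' B := by
      rintro _ ⟨x, hx, rfl⟩
      obtain ⟨x', hx', hxx⟩ := hDU hx
      rwa [← Subtype.ext hxx]
    rw [← inter_eq_left.2 hDS, measure_inter_compl_eq hS hO ψ hψ hD]
    refine weightedVolume_eq_zero_of_volume_eq_zero φ p
      (hj.measurableSet_image' (measurable_subtype_coe hD)) (hjD.trans ?_) ?_
    · rintro _ ⟨y, hy, rfl⟩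
      exact e.map_target (hBt hy)
    · rw [hpre] at h0
      refine measure_mono_null ?_ h0
      rintro y ⟨hy, hyt⟩
      obtain ⟨z, hz, hzy⟩ := hjD hy
      exact ⟨e.symm.injOn (hBt hz) hyt hzy ▸ hz, hy⟩

/-! ### From local to global constancy -/

/-- A function that is locally a.e. constant on a preconnected open set whose nonempty open subsets
have positive measure is a.e. constant there. -/
theorem exists_ae_eq_const_of_locally {X : Type*} [TopologicalSpace X] [SecondCountableTopology X]
    [MeasurableSpace X] {m : Measure X} {A : Set X} (hA : IsPreconnected A)
    (hpos : ∀ V, IsOpen V → V ⊆ A → V.Nonempty → m V ≠ 0) {β : Type*} [Nonempty β]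
    {f : X → β} (hloc : ∀ x ∈ A, ∃ (U : Set X) (c : β), IsOpen U ∧ x ∈ U ∧ U ⊆ A ∧
      m {y ∈ U | f y ≠ c} = 0) :
    ∃ c : β, m {y ∈ A | f y ≠ c} = 0 := by
  choose! U c hU hxU hUA hc using hloc
  -- The overlap of `U x` and `U y` is open and contains `y`, so it has positive measure, and two
  -- different constants cannot both be a.e. values on it.
  have hcc : ∀ x ∈ A, ∀ y ∈ U x, c y = c x := by
    intro x hx y hy
    by_contra hne
    have hyA := hUA x hx hy
    refine hpos (U x ∩ U y) ((hU x hx).inter (hU y hyA))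
      (inter_subset_left.trans (hUA x hx)) ⟨y, hy, hxU y hyA⟩ ?_
    refine measure_mono_null ?_ (measure_union_null (hc x hx) (hc y hyA))
    rintro z ⟨hzx, hzy⟩
    by_cases h : f z = c x
    · exact Or.inr ⟨hzy, fun h' => hne (h'.symm.trans h)⟩
    · exact Or.inl ⟨hzx, h⟩
  -- For the discrete topology on `β`, the locally constant choice `c` is continuous, hence constant
  -- on the preconnected set.
  let _ : TopologicalSpace β := ⊥
  have : DiscreteTopology β := ⟨rfl⟩
  have hcont : ContinuousOn c A := by
    intro x hx
    refine ContinuousAt.continuousWithinAt ?_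
    refine (continuousAt_const (y := c x)).congr ?_
    filter_upwards [(hU x hx).mem_nhds (hxU x hx)] with y hy
    exact (hcc x hx y hy).symm
  rcases A.eq_empty_or_nonempty with rfl | ⟨a, ha⟩
  · exact ⟨Classical.arbitrary β, by simp⟩
  have hconst : ∀ x ∈ A, c x = c a := by
    intro x hx
    exact hA.constant hcont hx ha
  refine ⟨c a, measure_null_of_locally_null _ fun x hx => ?_⟩
  refine ⟨U x ∩ {y ∈ A | f y ≠ c a}, inter_mem (mem_nhdsWithin_of_mem_nhds
    ((hU x hx.1).mem_nhds (hxU x hx.1))) self_mem_nhdsWithin, ?_⟩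
  refine measure_mono_null ?_ (hc x hx.1)
  rintro y ⟨hy, -, hy'⟩
  exact ⟨hy, (hconst x hx.1).symm ▸ hy'⟩

theorem proposition3p7
    {X : Type*} [MetricSpace X] [CompleteSpace X] [TopologicalSpace.SeparableSpace X]
    [MeasurableSpace X] [BorelSpace X] (m : Measure X) [SigmaFinite m]
    {n : ℕ} {M : Type*} [EMetricSpace M] [SecondCountableTopology M]
    [ChartedSpace (EuclideanSpace ℝ (Fin n)) M] [IsManifold (𝓡 n) ∞ M]
    [RiemannianBundle (fun x : M => TangentSpace (𝓡 n) x)]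
    [IsContMDiffRiemannianBundle (𝓡 n) ∞ (EuclideanSpace ℝ (Fin n))
      (fun x : M => TangentSpace (𝓡 n) x)]
    [IsRiemannianManifold (𝓡 n) M] [MeasurableSpace M] [BorelSpace M]
    (φ : M → ℝ) (hφ : ContMDiff (𝓡 n) 𝓘(ℝ, ℝ) ∞ φ)
    (S : Set X) (hS : IsClosed S) (O : Set M) (hO : IsOpen O)
    (ψ : ↥(Sᶜ) ≃ᵢ ↥O)
    (hψ : (m.comap (Subtype.val : ↥(Sᶜ) → X)).map (fun x => (ψ x : M)) =
      (weightedVolume n φ).restrict O)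
    (hmS : m S = 0)
    (hconn : ConnectedByRectifiableCurves Sᶜ) :
    L2Liouville m := by
  intro f _ hlap
  obtain ⟨F, hF, hconv⟩ := exists_tendsto_of_isRelaxedGradient_zero
    (isRelaxedGradient_of_cheegerEnergy_eq_zero (cheegerEnergy_eq_zero_of_isLaplacian hlap))
  have : SecondCountableTopology X := UniformSpace.secondCountable_of_separable X
  have : IsManifold (𝓡 n) 1 M := IsManifold.of_le (n := ∞) (by simp)
  have : IsContinuousRiemannianBundle (EuclideanSpace ℝ (Fin n))
      (fun x : M => TangentSpace (𝓡 n) x) := by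
    obtain ⟨g, hg, hg'⟩ := IsContMDiffRiemannianBundle.exists_contMDiff (IB := 𝓡 n) (n := ∞)
      (F := EuclideanSpace ℝ (Fin n)) (E := fun x : M => TangentSpace (𝓡 n) x)
    exact ⟨g, hg.continuous, hg'⟩
  have hpre : IsPreconnected Sᶜ := by
    refine isPreconnected_of_forall_pair fun x hx y hy => ?_
    obtain ⟨γ, hγ, -⟩ := hconn x hx y hy
    exact ⟨range γ, range_subset_iff.2 hγ, ⟨0, γ.source⟩, ⟨1, γ.target⟩,
      isPreconnected_range γ.continuous⟩
  have hfm : Measurable f := (Lp.stronglyMeasurable f).measurable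
  have hparam := fun x₀ (hx₀ : x₀ ∈ Sᶜ) =>
    exists_local_parametrization hφ.continuous hS hO ψ hψ hx₀
  have hpos : ∀ V, IsOpen V → V ⊆ Sᶜ → V.Nonempty → m V ≠ 0 := by
    rintro V hV hVS ⟨x₀, hx₀⟩ hV0
    obtain ⟨y₀, r, q, C, c, U, hr, -, hc, -, -, hq₀, hlip, hvol, -⟩ := hparam x₀ (hVS hx₀)
    have h1 := hvol V hV.measurableSet
    rw [hV0, nonpos_iff_eq_zero, mul_eq_zero, or_iff_right hc] at h1
    have hcont : ContinuousAt q y₀ :=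
      hlip.continuousOn.continuousAt (Metric.ball_mem_nhds y₀ hr)
    have h2 : Metric.ball y₀ r ∩ q ⁻¹' V ∈ 𝓝 y₀ :=
      inter_mem (Metric.ball_mem_nhds y₀ hr) (hcont.preimage_mem_nhds
        (by rw [hq₀]; exact hV.mem_nhds hx₀))
    exact (Measure.measure_pos_of_mem_nhds volume h2).ne' h1
  have hloc : ∀ x ∈ Sᶜ, ∃ (U : Set X) (c : ℝ), IsOpen U ∧ x ∈ U ∧ U ⊆ Sᶜ ∧
      m {y ∈ U | f y ≠ c} = 0 := by
    intro x₀ hx₀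
    obtain ⟨y₀, r, q, C, c, U, hr, hC, hc, hc', hqm, hq₀, hlip, hvol, hU, hxU, hUS, hnull⟩ :=
      hparam x₀ hx₀
    set B := Metric.ball y₀ r
    have hBm : MeasurableSet B := Metric.isOpen_ball.measurableSet
    have hBf : volume B ≠ ⊤ := measure_ball_lt_top.ne
    -- The factor `c` brings the image of Lebesgue measure below `m`, so the L¹(ν) convergence
    -- applies; dividing by `c` returns it to the ball.
    set ν : Measure X := c • (volume.restrict B).map q with hν
    have hνm : ν ≤ m := Measure.le_iff.2 fun D hD => by
      rw [hν, Measure.smul_apply, Measure.map_apply hqm hD, Measure.restrict_apply (hqm hD),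
        inter_comm]
      exact hvol D hD
    have hνf : IsFiniteMeasure ν := by
      refine ⟨?_⟩
      rw [hν, Measure.smul_apply, Measure.map_apply hqm MeasurableSet.univ]
      simpa using ENNReal.mul_lt_top hc'.lt_top hBf.lt_top
    have hν' : ∀ g : X → ℝ≥0∞, Measurable g → ∫⁻ y in B, g (q y) = c⁻¹ * ∫⁻ x, g x ∂ν := by
      intro g hg
      rw [hν, lintegral_smul_measure, lintegral_map hg hqm, smul_eq_mul, ← mul_assoc,
        ENNReal.inv_mul_cancel hc hc', one_mul]
    obtain ⟨h1, h2⟩ := hconv ν hνf hνm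
    have hFm : ∀ k, Continuous (F k) := fun k => (hF k).elim fun K hK => hK.continuous
    have hscale : ∀ u : ℕ → ℝ≥0∞, Tendsto u atTop (𝓝 0) →
        Tendsto (fun k => c⁻¹ * u k) atTop (𝓝 0) := fun u hu => by
      simpa using ENNReal.Tendsto.const_mul hu (a := c⁻¹)
        (Or.inr (ENNReal.inv_ne_top.2 hc))
    obtain ⟨a, ha⟩ := ae_eq_const_of_tendsto_slopeAt volume (convex_ball y₀ r) hBm hBf
      (D := (2 * r).toNNReal) (by simpa using hr)
      (fun x hx y hy => by
        have h := dist_triangle_right x y y₀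
        have hx' : dist x y₀ < r := hx
        have hy' : dist y y₀ < r := hy
        rw [Real.coe_toNNReal _ (by positivity)]
        linarith)
      hqm hC hlip hfm hF
      ((hscale _ h1).congr fun k => (hν' (fun x => ‖F k x - f x‖ₑ)
        ((hFm k).measurable.sub hfm).enorm).symm)
      ((hscale _ h2).congr fun k => (hν' _ (measurable_slopeAt (hFm k))).symm)
    -- The exceptional set in `U` has a Lebesgue null preimage in the ball, hence is `m`-null.
    refine ⟨U, a, hU, hxU, hUS, hnull _ ?_ (fun y hy => hy.1) ?_⟩
    · exact hU.measurableSet.inter (hfm (measurableSet_singleton a).compl)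
    · rw [ae_restrict_iff' hBm, ae_iff] at ha
      refine measure_mono_null ?_ ha
      rintro y ⟨hyB, -, hy⟩
      simp only [mem_ofPred_eq, Classical.not_imp]
      exact ⟨hyB, hy⟩
  obtain ⟨c, hc⟩ := exists_ae_eq_const_of_locally hpre hpos hloc
  refine ⟨c, ?_⟩
  rw [ae_iff]
  refine measure_mono_null (fun x hx => ?_) (measure_union_null hmS hc)
  by_cases hxS : x ∈ S
  · exact Or.inl hxS
  · exact Or.inr ⟨hxS, hx⟩
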